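/- Let $p$ be a prime and let $P$ be a metabelian $p$-group, that is, a finite group of $p$-power order whose derived subgroup is abelian. Let $\chi$ be a complex irreducible character of $P$ (so that its degree $\chi(1)$ is a positive integer), and let $\mathrm{Supp}(\chi)=\{g\in P : \chi(g)\neq 0\}$. Then: (1) $\mathrm{Supp}(\chi)$ contains at most $|P|/\chi(1)^2$ conjugacy classes of $P$. (2) If $p$ is odd, then every element of $\mathrm{Supp}(\chi)$ has order at most $|P|/\chi(1)^{3/2}$. -/

import Mathlib

/-- A group is metabelian if its derived subgroup is abelian. -/
def IsMetabelian (G : Type*) [Group G] : Prop :=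
  ∀ x ∈ commutator G, ∀ y ∈ commutator G, x * y = y * x

/-- `Irr(G)`: the set of complex irreducible characters of `G`, i.e. of the trace functions of
irreducible (in particular nonzero) finite-dimensional complex representations of `G`. Every
finite-dimensional complex vector space is isomorphic to some `Fin n → ℂ`. -/
def Irr (G : Type*) [Group G] : Set (G → ℂ) :=
  {χ | ∃ (n : ℕ) (ρ : Representation ℂ G (Fin n → ℂ)), ρ.IsIrreducible ∧ ρ.character = χ}

/-- `Supp(χ)`: the set of group elements on which `χ` does not vanish. -/
def Supp {G : Type*} (χ : G → ℂ) : Set G := {g | χ g ≠ 0}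

/-- The number of conjugacy classes of `G` contained in a subset `S`. -/
noncomputable def numConjClasses {G : Type*} [Group G] (S : Set G) : ℕ :=
  Set.ncard {C : ConjClasses G | C.carrier ⊆ S}

/-! Among the stabilisers of lines in the representation that contain `P'`, let `Z` be a maximal
one, acting on its line by the linear character `μ`. Maximality makes `Z` the full stabiliser of
`μ`, so `χ` is induced from `μ`: the degree is `d = |P : Z|`, `χ` vanishes off `Z`, and on `Z` it is
up to a factor the sum of the conjugates of `μ`. Dividing `Z` by the common kernel `K` of these
conjugates gives an abelian `p`-group `A` on which the elements of `P` act as commuting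
automorphisms, with a character `ψ` whose conjugates separate points. Write `S(a) = ∑ ψ(ga)` and let
`T ≤ Z` be the stabiliser of `ψ`. Since `|A| |K| = |Z|`, both claims become bounds by `|A| |T|`.

(1) By Burnside counting it suffices that `∑ |Stab a|` over `S(a) ≠ 0` is at most `|A| |T|`
(`sum_stabilizer_le`). Enlarge `Stab a` to the group `D(a)` of those `k` that fix `ψ` on all `ga -
a`. There `k ↦ ψ(ka - a)` is a homomorphism, trivial if `S(a) ≠ 0`. Hence the sum is at most `∑ ψ(ka
- a)` over pairs with `k ∈ D(a)`. For fixed `k` this is a character sum over a subgroup of `A`,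
equal to `|A|` for `k ∈ T` and to `0` otherwise.

(2) Let `M` be the submodule generated by `a`. A second moment gives `|Stab a| |M| ≤ |A| |T|`. For
`p` odd and `S(a) ≠ 0`, the translates of the orbit of `a` by suitable multiples of an element of
`M` are disjoint, whence `|Pa| o(a) ≤ |M|`. The product is `|P| o(a) ≤ |A| |T|`, which yields the
stronger order bound `|P| / d ^ 2`. -/

/-! ### Orbit sums of a character and the count of orbits where they do not vanish. -/

section CharacterSums

variable {G A : Type*} [Group G] [AddCommGroup A] [DistribMulAction G A]

/-- A nontrivial invariant subgroup of a finite abelian `p`-group on which a finite `p`-group acts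
contains a nonzero fixed vector. -/
lemma exists_fixed_ne_zero {p : ℕ} (hp : p.Prime) (hG : IsPGroup p G) [Finite A]
    (hA : ∃ m, Nat.card A = p ^ m) (H : AddSubgroup A)
    (hst : ∀ (g : G), ∀ a ∈ H, g • a ∈ H) (hH : H ≠ ⊥) :
    ∃ w ∈ H, w ≠ 0 ∧ ∀ g : G, g • w = w := by
  have := Fact.mk hp
  let _ : MulAction G H :=
    { smul := fun g h => ⟨g • (h : A), hst g h h.2⟩
      one_smul := fun h => Subtype.ext (one_smul G (h : A))
      mul_smul := fun g g' h => Subtype.ext (mul_smul g g' (h : A)) }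
  have hcoe : ∀ (g : G) (h : H), ((g • h : H) : A) = g • (h : A) := fun _ _ => rfl
  have hdvd : p ∣ Nat.card H := by
    obtain ⟨m, hm⟩ := hA
    have h1 : Nat.card H ∣ p ^ m := hm ▸ AddSubgroup.card_addSubgroup_dvd_card H
    obtain ⟨k, -, hk⟩ := (Nat.dvd_prime_pow hp).1 h1
    rcases k with _ | k
    · exact absurd (AddSubgroup.card_eq_one.1 (by simpa using hk)) hH
    · rw [hk]; exact dvd_pow_self p (Nat.succ_ne_zero k)
  have h0 : (0 : H) ∈ MulAction.fixedPoints G H := fun g => Subtype.ext (smul_zero g)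
  obtain ⟨b, hb, hne⟩ :=
    hG.exists_fixed_point_of_prime_dvd_card_of_fixed_point H hdvd h0
  refine ⟨b, b.2, fun h => hne (Subtype.ext h.symm), fun g => ?_⟩
  rw [← hcoe, hb g]

variable (G) in
/-- The sum of a character over the orbit of an element, with multiplicity. -/
noncomputable def orbitSum [Fintype G] (ψ : AddChar A ℂ) (a : A) : ℂ := ∑ g : G, ψ (g • a)

lemma orbitSum_smul [Fintype G] (ψ : AddChar A ℂ) (k : G) (a : A) :
    orbitSum G ψ (k • a) = orbitSum G ψ a := by
  unfold orbitSum
  refine Fintype.sum_equiv (Equiv.mulRight k) _ _ fun g => ?_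
  simp [mul_smul]

lemma orbitSum_add_fixed [Fintype G] (ψ : AddChar A ℂ) (a w : A) (hw : ∀ g : G, g • w = w) :
    orbitSum G ψ (a + w) = ψ w * orbitSum G ψ a := by
  simp [orbitSum, hw, AddChar.map_add_eq_mul, Finset.mul_sum, mul_comm]

variable (G) in
/-- The stabiliser of a character. -/
def charStab (ψ : AddChar A ℂ) : Subgroup G where
  carrier := {g | ∀ a, ψ (g • a) = ψ a}
  one_mem' := fun a => by simp
  mul_mem' := fun {g h} hg hh a => by rw [mul_smul, hg, hh]
  inv_mem' := fun {g} hg a => by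
    have := hg (g⁻¹ • a)
    rw [smul_inv_smul] at this
    exact this.symm

lemma mem_charStab (ψ : AddChar A ℂ) (g : G) : g ∈ charStab G ψ ↔ ∀ a, ψ (g • a) = ψ a := Iff.rfl

/-- The elements fixing `ψ` on all `g • a - a`. -/
def diffStab (_hcomm : ∀ (g h : G) (a : A), g • h • a = h • g • a) (ψ : AddChar A ℂ) (a : A) :
    Subgroup G where
  carrier := {k | ∀ g : G, ψ (k • (g • a - a)) = ψ (g • a - a)}
  one_mem' := fun g => by simp
  mul_mem' := by
    intro k k' hk hk' g
    have h1 : (k * k') • (g • a - a) = k • ((k' * g) • a - a) - k • (k' • a - a) := by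
      simp only [mul_smul, smul_sub]; abel
    have h2 : k' • (g • a - a) = ((k' * g) • a - a) - (k' • a - a) := by
      simp only [mul_smul, smul_sub]; abel
    rw [← hk' g, h1, h2, AddChar.map_sub_eq_div, hk, hk, ← AddChar.map_sub_eq_div]
  inv_mem' := by
    intro k hk g
    have h1 : k⁻¹ • (g • a - a) = ((k⁻¹ * g) • a - a) - (k⁻¹ • a - a) := by
      simp only [mul_smul, smul_sub]; abel
    rw [h1, AddChar.map_sub_eq_div, ← hk, ← hk (k⁻¹), ← AddChar.map_sub_eq_div]
    congr 1
    simp only [mul_smul, smul_sub, smul_inv_smul]; abel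

variable (hcomm : ∀ (g h : G) (a : A), g • h • a = h • g • a) (ψ : AddChar A ℂ)
include hcomm

/-- The character `k ↦ ψ (k • a - a)` of `diffStab`. -/
noncomputable def diffHom (a : A) : diffStab hcomm ψ a →* ℂ where
  toFun := fun k => ψ ((k : G) • a - a)
  map_one' := by simp
  map_mul' := by
    intro k k'
    have h1 : ((k * k' : diffStab hcomm ψ a) : G) • a - a
        = (k : G) • ((k' : G) • a - a) + ((k : G) • a - a) := by
      rw [Subgroup.coe_mul, mul_smul, smul_sub]; abel
    rw [h1, AddChar.map_add_eq_mul, k.2 k', mul_comm]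

lemma stabilizer_le_diffStab (a : A) : MulAction.stabilizer G a ≤ diffStab hcomm ψ a := by
  intro k hk g
  rw [MulAction.mem_stabilizer_iff] at hk
  rw [smul_sub, hcomm, hk]

open Classical in
lemma sum_diffStab_eq [Fintype G] (a : A) :
    (∑ k : G, if k ∈ diffStab hcomm ψ a then ψ (k • a - a) else 0)
      = if diffHom hcomm ψ a = 1 then (Nat.card (diffStab hcomm ψ a) : ℂ) else 0 := by
  rw [← Finset.sum_filter]
  have h : (∑ k ∈ Finset.univ.filter (fun k : G => k ∈ diffStab hcomm ψ a), ψ (k • a - a))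
      = ∑ k : diffStab hcomm ψ a, diffHom hcomm ψ a k := by
    refine Finset.sum_subtype _ (by simp) (fun k => ψ (k • a - a))
  rw [h, sum_hom_units, Nat.card_eq_fintype_card]
  split_ifs <;> simp

/-- For `k` in `diffStab`, replacing `a` by `k • a` multiplies every term of the orbit sum by `ψ (k
• a - a)`, yet only permutes the terms. -/
lemma diffHom_eq_one [Fintype G] (a : A) (ha : orbitSum G ψ a ≠ 0) :
    diffHom hcomm ψ a = 1 := by
  ext k
  have h : orbitSum G ψ a = diffHom hcomm ψ a k * orbitSum G ψ a := by
    conv_lhs => rw [← orbitSum_smul ψ (k : G) a]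
    unfold orbitSum
    rw [Finset.mul_sum]
    refine Finset.sum_congr rfl fun g _ => ?_
    have h1 : g • (k : G) • a = (k : G) • (g • a - a) - (g • a - a) + ((k : G) • a - a) + g • a := by
      rw [smul_sub, hcomm]; abel
    rw [h1, AddChar.map_add_eq_mul, AddChar.map_add_eq_mul, AddChar.map_sub_eq_div, k.2 g,
      div_self (AddChar.val_isUnit ψ _).ne_zero, one_mul]
    rfl
  have h2 : (diffHom hcomm ψ a k - 1) * orbitSum G ψ a = 0 := by
    rw [sub_mul, one_mul, ← h, sub_self]
  simpa [ha, sub_eq_zero] using h2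

variable (faith : ∀ a, (∀ g : G, ψ (g • a) = 1) → a = 0)
include faith

lemma smul_eq_of_mem_charStab (t : G) (ht : t ∈ charStab G ψ) (a : A) : t • a = a := by
  rw [← sub_eq_zero]
  refine faith _ fun g => ?_
  rw [smul_sub, hcomm, AddChar.map_sub_eq_div, ht, div_self (AddChar.val_isUnit ψ _).ne_zero]

-- With `k` fixed, the admissible `a` form a subgroup `W` and `a ↦ ψ (k • a - a)` is a character of
-- it. If `k` moves `ψ`, this character is nontrivial: `(k - 1)A` contains a nonzero `G`-fixed `w =
-- k • a - a`. Being fixed puts `a` in `W`, and faithfulness gives `ψ w ≠ 1`.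
open Classical in
lemma sum_diffStab_swap {p : ℕ} (hp : p.Prime) (hG : IsPGroup p G) [Fintype G] [Fintype A]
    (hA : ∃ m, Nat.card A = p ^ m) (k : G) :
    (∑ a : A, if k ∈ diffStab hcomm ψ a then ψ (k • a - a) else 0)
      = if k ∈ charStab G ψ then (Nat.card A : ℂ) else 0 := by
  split_ifs with hk
  · have h : ∀ a : A, (if k ∈ diffStab hcomm ψ a then ψ (k • a - a) else 0) = 1 := by
      intro a
      have hka := smul_eq_of_mem_charStab hcomm ψ faith k hk
      rw [if_pos, hka, sub_self, AddChar.map_zero_eq_one]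
      intro g
      rw [hka]
    simp [h]
  · let W : AddSubgroup A :=
      { carrier := {a | k ∈ diffStab hcomm ψ a}
        zero_mem' := fun g => by simp
        add_mem' := by
          intro a b ha hb g
          have h1 : g • (a + b) - (a + b) = (g • a - a) + (g • b - b) := by
            rw [smul_add]; abel
          rw [h1, smul_add, AddChar.map_add_eq_mul, AddChar.map_add_eq_mul, ha g, hb g]
        neg_mem' := by
          intro a ha g
          have h1 : g • (-a) - (-a) = -(g • a - a) := by
            rw [smul_neg]; abel
          rw [h1, smul_neg, AddChar.map_neg_eq_inv, AddChar.map_neg_eq_inv, ha g] }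
    let L : AddChar W ℂ :=
      { toFun := fun a => ψ (k • (a : A) - a)
        map_zero_eq_one' := by simp
        map_add_eq_mul' := by
          intro a b
          have h1 : k • ((a + b : W) : A) - ((a + b : W) : A)
              = (k • (a : A) - a) + (k • (b : A) - b) := by
            rw [AddSubgroup.coe_add, smul_add]; abel
          rw [h1, AddChar.map_add_eq_mul] }
    have hsum : (∑ a : A, if k ∈ diffStab hcomm ψ a then ψ (k • a - a) else 0)
        = ∑ a : W, L a := by
      rw [← Finset.sum_filter]
      exact Finset.sum_subtype _ (by intro x; simp; rfl) (fun a => ψ (k • a - a))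
    rw [hsum, AddChar.sum_eq_ite, if_neg]
    let H : AddSubgroup A := (DistribSMul.toAddMonoidHom A k - AddMonoidHom.id A).range
    have hmem : ∀ x, x ∈ H ↔ ∃ a, k • a - a = x := fun x => Iff.rfl
    have hH : H ≠ ⊥ := by
      intro hbot
      apply hk
      intro a
      have : k • a - a ∈ H := ⟨a, rfl⟩
      rw [hbot, AddSubgroup.mem_bot, sub_eq_zero] at this
      rw [this]
    obtain ⟨w, hwH, hw0, hw⟩ := exists_fixed_ne_zero hp hG hA H (by
      rintro g x ⟨a, rfl⟩
      refine (hmem _).2 ⟨g • a, ?_⟩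
      change _ = g • (k • a - a)
      rw [smul_sub, hcomm]) hH
    obtain ⟨a, ha⟩ := (hmem w).1 hwH
    have haW : k ∈ diffStab hcomm ψ a := by
      intro g
      have h1 : k • (g • a - a) = g • a - a + (g • w - w) := by
        rw [← ha, smul_sub, smul_sub, hcomm]; abel
      rw [h1, hw, sub_self, add_zero]
    intro hL
    apply hw0
    refine faith w fun g => ?_
    rw [hw, ← ha]
    exact DFunLike.congr_fun hL ⟨a, haW⟩

open Classical in
/-- The number of orbits on which the orbit sum of `ψ` does not vanish, in Burnside form. -/
theorem sum_stabilizer_le {p : ℕ} (hp : p.Prime) (hG : IsPGroup p G) [Fintype G] [Fintype A]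
    (hA : ∃ m, Nat.card A = p ^ m) :
    (∑ a : A, if orbitSum G ψ a ≠ 0 then Nat.card (MulAction.stabilizer G a) else 0)
      ≤ Nat.card A * Nat.card (charStab G ψ) := by
  -- Both sides evaluate the sum of `ψ (k • a - a)` over pairs with `k ∈ diffStab a`, summed over
  -- `k` first and over `a` first.
  have h1 : (∑ a : A, if diffHom hcomm ψ a = 1 then Nat.card (diffStab hcomm ψ a) else 0)
      = Nat.card A * Nat.card (charStab G ψ) := by
    have h2 : (∑ a : A, ∑ k : G, if k ∈ diffStab hcomm ψ a then ψ (k • a - a) else 0)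
        = Nat.card A * Nat.card (charStab G ψ) := by
      rw [Finset.sum_comm]
      simp_rw [sum_diffStab_swap hcomm ψ faith hp hG hA]
      rw [← Finset.sum_filter, Finset.sum_const, nsmul_eq_mul, mul_comm, Nat.card_eq_fintype_card,
        Nat.card_eq_fintype_card, Fintype.card_subtype]
    simp_rw [sum_diffStab_eq] at h2
    exact_mod_cast h2
  rw [← h1]
  refine Finset.sum_le_sum fun a _ => ?_
  by_cases ha : orbitSum G ψ a ≠ 0
  · rw [if_pos ha, if_pos (diffHom_eq_one hcomm ψ a ha)]
    exact Subgroup.card_le_of_le (stabilizer_le_diffStab hcomm ψ a)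
  · rw [if_neg ha]; exact Nat.zero_le _

end CharacterSums

/-! ### Binomial congruences for `p`-power iterates of an automorphism. -/

section PowerMap

variable {G A : Type*} [Group G] [AddCommGroup A] [DistribMulAction G A]

/-- The binomial expansion of `(1 + Y) ^ n` with `Y = k - 1`; only the divisibility of the terms
from `Y ^ 3` on matters, so they are gathered into one. -/
lemma pow_smul_eq_sum_diff (k : G) (M : AddSubgroup A) (Y : A →+ A) (hY : ∀ x, Y x = k • x - x)
    (hM : ∀ x ∈ M, Y x ∈ M) (n : ℕ) (x : A) (hx : x ∈ M) :
    ∃ v ∈ M, k ^ n • x = x + n • Y x + n.choose 2 • Y (Y x) + Y (Y (Y v)) := by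
  induction n with
  | zero => exact ⟨0, M.zero_mem, by simp⟩
  | succ n ih =>
    obtain ⟨v, hv, h⟩ := ih
    refine ⟨v + n.choose 2 • x + Y v,
      M.add_mem (M.add_mem hv (M.nsmul_mem hx _)) (hM v hv), ?_⟩
    have hk : ∀ y, k • y = y + Y y := fun y => by rw [hY]; abel
    rw [pow_succ', mul_smul, h, hk, Nat.choose_succ_succ' n 1, Nat.choose_one_right]
    simp only [map_add, map_nsmul, add_smul, one_smul]
    abel

/-- Each `Y` contributes `p ^ i`. Oddness gives `p ∣ p.choose 2`, so the quadratic term is divisible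
by `p ^ (2 * i + 1)` and the cubic one by `p ^ (3 * i)`. Both exponents are at least `i + 2` because
`i ≥ 1`. -/
lemma pow_prime_smul_sub {p : ℕ} (hp : p.Prime) (hodd : Odd p) (k : G) (M : AddSubgroup A)
    {i : ℕ} (hi : 1 ≤ i) (h : ∀ x ∈ M, ∃ y ∈ M, k • x - x = p ^ i • y) (x : A) (hx : x ∈ M) :
    ∃ z ∈ M, k ^ p • x - x = p • (k • x - x) + p ^ (i + 2) • z := by
  let Y : A →+ A := DistribSMul.toAddMonoidHom A k - AddMonoidHom.id A
  have hY : ∀ x, Y x = k • x - x := fun x => rfl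
  have hMY : ∀ x ∈ M, Y x ∈ M := by
    intro x hx
    obtain ⟨y, hy, hxy⟩ := h x hx
    rw [hY, hxy]
    exact M.nsmul_mem hy _
  have h' : ∀ x ∈ M, ∃ y ∈ M, Y x = p ^ i • y := h
  obtain ⟨v, hv, hpow⟩ := pow_smul_eq_sum_diff k M Y hY hMY p x hx
  obtain ⟨y₁, hy₁, e₁⟩ := h' x hx
  obtain ⟨y₂, hy₂, e₂⟩ := h' y₁ hy₁
  obtain ⟨v₁, hv₁, f₁⟩ := h' v hv
  obtain ⟨v₂, hv₂, f₂⟩ := h' v₁ hv₁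
  obtain ⟨v₃, hv₃, f₃⟩ := h' v₂ hv₂
  obtain ⟨c, hc⟩ : p ∣ p.choose 2 := by
    refine hp.dvd_choose_self (by norm_num) ?_
    obtain ⟨m, hm⟩ := hodd
    have := hp.two_le
    omega
  -- The exponents left over are `2i + 1 - (i + 2) = i - 1` and `3i - (i + 2) = 2(i - 1)`.
  refine ⟨(c * p ^ (i - 1)) • y₂ + p ^ (2 * (i - 1)) • v₃,
    M.add_mem (M.nsmul_mem hy₂ _) (M.nsmul_mem hv₃ _), ?_⟩
  have hYY : Y (Y x) = (p ^ i * p ^ i) • y₂ := by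
    rw [e₁, map_nsmul, e₂, smul_smul]
  have hYYY : Y (Y (Y v)) = (p ^ i * (p ^ i * p ^ i)) • v₃ := by
    rw [f₁, map_nsmul, map_nsmul, f₂, map_nsmul, f₃, smul_smul, smul_smul, mul_assoc]
  rw [hpow, hYY, hYYY, hc, smul_add, smul_smul, smul_smul, smul_smul, ← hY]
  obtain ⟨j, rfl⟩ : ∃ j, i = j + 1 := ⟨i - 1, by omega⟩
  have n₁ : p * c * (p ^ (j + 1) * p ^ (j + 1)) = p ^ (j + 1 + 2) * (c * p ^ (j + 1 - 1)) := by
    rw [Nat.add_sub_cancel]; ring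
  have n₂ : p ^ (j + 1) * (p ^ (j + 1) * p ^ (j + 1))
      = p ^ (j + 1 + 2) * p ^ (2 * (j + 1 - 1)) := by
    rw [Nat.add_sub_cancel]; ring
  rw [n₁, n₂]
  abel

lemma pow_prime_pow_smul_sub {p : ℕ} (hp : p.Prime) (hodd : Odd p) (k : G) (M : AddSubgroup A)
    {i : ℕ} (hi : 1 ≤ i) (h : ∀ x ∈ M, ∃ y ∈ M, k • x - x = p ^ i • y) (s : ℕ) :
    ∀ x ∈ M, ∃ z ∈ M, k ^ p ^ s • x - x = p ^ s • (k • x - x) + p ^ (i + s + 1) • z := by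
  induction s with
  | zero => exact fun x _ => ⟨0, M.zero_mem, by simp⟩
  | succ s ih =>
    intro x hx
    have h' : ∀ x ∈ M, ∃ y ∈ M, k ^ p ^ s • x - x = p ^ (i + s) • y := by
      intro x hx
      obtain ⟨z, hz, e⟩ := ih x hx
      obtain ⟨y, hy, e'⟩ := h x hx
      refine ⟨y + p • z, M.add_mem hy (M.nsmul_mem hz _), ?_⟩
      rw [e, e', smul_add, smul_smul, smul_smul, pow_succ, pow_add, mul_comm (p ^ s)]
    obtain ⟨z, hz, e⟩ := ih x hx
    obtain ⟨z', hz', e'⟩ := pow_prime_smul_sub hp hodd (k ^ p ^ s) M (by omega) h' x hx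
    refine ⟨z + z', M.add_mem hz hz', ?_⟩
    rw [pow_succ p s, pow_mul, e', e]
    simp only [smul_add, smul_smul]
    rw [show p * p ^ (i + s + 1) = p ^ (i + (s + 1) + 1) by ring,
      show p * p ^ s = p ^ s * p by ring, show i + s + 2 = i + (s + 1) + 1 by ring]
    abel

end PowerMap

/-! ### The submodule generated by an orbit and the order of its generator. -/

section OrbitModule

variable {G A : Type*} [Group G] [AddCommGroup A] [DistribMulAction G A]

lemma smul_mem_closure_orbit (g : G) {a x : A}
    (hx : x ∈ AddSubgroup.closure (MulAction.orbit G a)) :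
    g • x ∈ AddSubgroup.closure (MulAction.orbit G a) := by
  induction hx using AddSubgroup.closure_induction with
  | mem x hx =>
    exact AddSubgroup.subset_closure (MulAction.mem_orbit_of_mem_orbit g hx)
  | zero => rw [smul_zero]; exact AddSubgroup.zero_mem _
  | add x y _ _ hx hy => rw [smul_add]; exact AddSubgroup.add_mem _ hx hy
  | neg x _ hx => rw [smul_neg]; exact AddSubgroup.neg_mem _ hx

lemma nsmul_eq_zero_of_mem_closure_orbit {n : ℕ} {a x : A} (ha : n • a = 0)
    (hx : x ∈ AddSubgroup.closure (MulAction.orbit G a)) : n • x = 0 := by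
  induction hx using AddSubgroup.closure_induction with
  | mem x hx => obtain ⟨g, rfl⟩ := hx; change n • g • a = 0; rw [smul_comm, ha, smul_zero]
  | zero => rw [smul_zero]
  | add x y _ _ hx hy => rw [smul_add, hx, hy, add_zero]
  | neg x _ hx => rw [smul_neg, hx, neg_zero]

variable (hcomm : ∀ (g h : G) (a : A), g • h • a = h • g • a) (ψ : AddChar A ℂ)
include hcomm

lemma smul_eq_of_mem_closure_orbit {c : G} {a x : A} (hc : c ∈ MulAction.stabilizer G a)
    (hx : x ∈ AddSubgroup.closure (MulAction.orbit G a)) : c • x = x := by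
  rw [MulAction.mem_stabilizer_iff] at hc
  induction hx using AddSubgroup.closure_induction with
  | mem x hx => obtain ⟨g, rfl⟩ := hx; change c • g • a = g • a; rw [hcomm, hc]
  | zero => rw [smul_zero]
  | add x y _ _ hx hy => rw [smul_add, hx, hy]
  | neg x _ hx => rw [smul_neg, hx]

omit hcomm in
open Classical in
lemma sum_char_smul_div [Fintype A] (c d : G) :
    ∑ x : A, ψ (c • x) * (starRingEnd ℂ) (ψ (d • x))
      = if c * d⁻¹ ∈ charStab G ψ then (Nat.card A : ℂ) else 0 := by
  let L : AddChar A ℂ :=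
    { toFun := fun x => ψ (c • x - d • x)
      map_zero_eq_one' := by simp
      map_add_eq_mul' := by
        intro x y
        rw [← AddChar.map_add_eq_mul, smul_add, smul_add]
        congr 1
        abel }
  have hL : ∀ x, ψ (c • x) * (starRingEnd ℂ) (ψ (d • x)) = L x := by
    intro x
    change _ = ψ (c • x - d • x)
    rw [sub_eq_add_neg, AddChar.map_add_eq_mul, AddChar.map_neg_eq_conj]
  have hiff : L = 0 ↔ c * d⁻¹ ∈ charStab G ψ := by
    have hx : ∀ x, L x = 1 ↔ ψ (c • x) = ψ (d • x) := by
      intro x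
      change ψ (c • x - d • x) = 1 ↔ _
      rw [AddChar.map_sub_eq_div, div_eq_one_iff_eq (AddChar.val_isUnit ψ _).ne_zero]
    rw [AddChar.eq_zero_iff, mem_charStab]
    constructor
    · intro h x
      have := (hx (d⁻¹ • x)).1 (h _)
      rwa [smul_inv_smul, smul_smul] at this
    · intro h x
      rw [hx, ← h (d • x), smul_smul, inv_mul_cancel_right]
  simp_rw [hL]
  rw [AddChar.sum_eq_ite, Nat.card_eq_fintype_card]
  simp only [hiff]

-- Second moment of `x ↦ ∑ ψ (c • x)`, with `c` running over the stabiliser `D` of `a`.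
-- Orthogonality bounds it by `|D| |A| |charStab|`. On the submodule generated by `a`, `D` acts
-- trivially, so each `x` there contributes `|D| ^ 2`.
open Classical in
lemma card_stabilizer_mul_card_closure_le [Fintype G] [Fintype A] (a : A) :
    Nat.card (MulAction.stabilizer G a) * Nat.card (AddSubgroup.closure (MulAction.orbit G a))
      ≤ Nat.card A * Nat.card (charStab G ψ) := by
  set D := MulAction.stabilizer G a with hD
  set M := AddSubgroup.closure (MulAction.orbit G a) with hM
  have h1 : ∑ x : A, Complex.normSq (∑ c : D, ψ ((c : G) • x))
      = ∑ c : D, ∑ d : D, if (c : G) * (d : G)⁻¹ ∈ charStab G ψ then (Nat.card A : ℝ) else 0 := by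
    have : ((∑ x : A, Complex.normSq (∑ c : D, ψ ((c : G) • x)) : ℝ) : ℂ)
      = ∑ c : D, ∑ d : D, if (c : G) * (d : G)⁻¹ ∈ charStab G ψ then (Nat.card A : ℂ) else 0 := by
      push_cast
      simp_rw [← sum_char_smul_div, ← Complex.mul_conj, map_sum, Finset.sum_mul_sum]
      rw [Finset.sum_comm]
      refine Finset.sum_congr rfl fun c _ => ?_
      rw [Finset.sum_comm]
    refine Complex.ofReal_injective (this.trans ?_)
    simp only [Complex.ofReal_sum, apply_ite Complex.ofReal, Complex.ofReal_natCast,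
      Complex.ofReal_zero]
  have h2 : (Nat.card M * (Nat.card D) ^ 2 : ℝ)
      ≤ ∑ x : A, Complex.normSq (∑ c : D, ψ ((c : G) • x)) := by
    have h3 : ∀ x ∈ Finset.univ.filter (fun x : A => x ∈ M),
        Complex.normSq (∑ c : D, ψ ((c : G) • x)) = (Nat.card D : ℝ) ^ 2 := by
      intro x hx
      have h4 : ∀ c : D, (c : G) • x = x := fun c =>
        smul_eq_of_mem_closure_orbit hcomm c.2 (by simpa using hx)
      simp_rw [h4]
      rw [Finset.sum_const, nsmul_eq_mul, map_mul, Complex.normSq_eq_norm_sq (ψ x),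
        AddChar.norm_apply, Finset.card_univ, Nat.card_eq_fintype_card, Complex.normSq_natCast]
      ring
    calc (Nat.card M * (Nat.card D) ^ 2 : ℝ)
        = ∑ x ∈ Finset.univ.filter (fun x : A => x ∈ M),
          Complex.normSq (∑ c : D, ψ ((c : G) • x)) := by
          rw [Finset.sum_congr rfl h3, Finset.sum_const, nsmul_eq_mul, Nat.card_eq_fintype_card,
            Fintype.card_subtype]
      _ ≤ _ := Finset.sum_le_sum_of_subset_of_nonneg (Finset.filter_subset _ _)
          fun x _ _ => Complex.normSq_nonneg _
  have h5 : (∑ c : D, ∑ d : D, if (c : G) * (d : G)⁻¹ ∈ charStab G ψ then (Nat.card A : ℝ) else 0)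
      ≤ Nat.card D * (Nat.card A * Nat.card (charStab G ψ)) := by
    rw [Nat.card_eq_fintype_card (α := D), ← Finset.card_univ, ← nsmul_eq_mul]
    refine Finset.sum_le_card_nsmul _ _ _ fun c _ => ?_
    rw [← Finset.sum_filter, Finset.sum_const, nsmul_eq_mul, mul_comm]
    gcongr
    rw [Nat.card_eq_fintype_card, Fintype.card_subtype]
    refine Finset.card_le_card_of_injOn (fun d : D => (c : G) * (d : G)⁻¹) ?_ ?_
    · intro d hd
      simpa using hd
    · intro d _ d' _ h
      simpa using h
  have hpos : 0 < Nat.card D := Nat.card_pos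
  have h6 : (Nat.card M * (Nat.card D) ^ 2 : ℝ)
      ≤ Nat.card D * (Nat.card A * Nat.card (charStab G ψ)) := h2.trans (h1.le.trans h5)
  have h7 : Nat.card M * (Nat.card D) ^ 2 ≤ Nat.card D * (Nat.card A * Nat.card (charStab G ψ)) := by
    exact_mod_cast h6
  refine Nat.le_of_mul_le_mul_left ?_ hpos
  calc _ = Nat.card M * (Nat.card D) ^ 2 := by ring
    _ ≤ _ := h7

-- Such a `k` moves all of `M` by elements of `p ^ i M`. Its power `k ^ p ^ (e - i)` therefore
-- translates `g₀ • a` by exactly the fixed vector `u • p ^ e • b`, the error lying in `p ^ (e + 1)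
-- M = 0`. Invariance of the nonzero orbit sum forces `ψ` to be `1` on this vector, which is nonzero
-- since `p ∤ u`.
omit hcomm in
lemma not_orbit_eq_add (faith : ∀ a, (∀ g : G, ψ (g • a) = 1) → a = 0)
    (hcomm : ∀ (g h : G) (a : A), g • h • a = h • g • a)
    {p : ℕ} (hp : p.Prime) (hodd : Odd p) [Fintype G]
    {a b : A} (ha : orbitSum G ψ a ≠ 0) {e : ℕ} (hae : p ^ (e + 1) • a = 0)
    (hb : b ∈ AddSubgroup.closure (MulAction.orbit G a))
    (hb0 : p ^ e • b ≠ 0) (hbG : ∀ g : G, g • p ^ e • b = p ^ e • b)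
    (k g₀ : G) {i u : ℕ} (hi : 1 ≤ i) (hie : i ≤ e) (hu : ¬ p ∣ u)
    (h : k • g₀ • a = g₀ • a + (p ^ i * u) • b) : False := by
  have := Fact.mk hp
  set M := AddSubgroup.closure (MulAction.orbit G a) with hM
  have hkM : ∀ x ∈ M, ∃ y ∈ M, k • x - x = p ^ i • y := by
    intro x hx
    induction hx using AddSubgroup.closure_induction with
    | mem x hx =>
      obtain ⟨g, rfl⟩ := hx
      refine ⟨u • (g * g₀⁻¹) • b, M.nsmul_mem (smul_mem_closure_orbit _ hb) _, ?_⟩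
      have h1 : g • a = (g * g₀⁻¹) • g₀ • a := by rw [smul_smul, inv_mul_cancel_right]
      change k • g • a - g • a = _
      rw [h1, hcomm, h, smul_add, add_sub_cancel_left, smul_smul, smul_comm]
    | zero => exact ⟨0, M.zero_mem, by simp⟩
    | add x y _ _ hx hy =>
      obtain ⟨z, hz, e₁⟩ := hx
      obtain ⟨z', hz', e₂⟩ := hy
      refine ⟨z + z', M.add_mem hz hz', ?_⟩
      rw [smul_add, smul_add, ← e₁, ← e₂]; abel
    | neg x _ hx =>
      obtain ⟨z, hz, e₁⟩ := hx
      refine ⟨-z, M.neg_mem hz, ?_⟩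
      rw [smul_neg, smul_neg, ← e₁]; abel
  have hg₀ : g₀ • a ∈ M := AddSubgroup.subset_closure (MulAction.mem_orbit a g₀)
  obtain ⟨z, hz, e₁⟩ := pow_prime_pow_smul_sub hp hodd k M hi hkM (e - i) _ hg₀
  have hz0 : p ^ (i + (e - i) + 1) • z = 0 := by
    rw [Nat.add_sub_cancel' hie]
    exact nsmul_eq_zero_of_mem_closure_orbit hae hz
  have hw : k ^ p ^ (e - i) • g₀ • a = g₀ • a + u • p ^ e • b := by
    rw [← sub_eq_iff_eq_add', e₁, hz0, add_zero, h, add_sub_cancel_left, smul_smul, smul_smul]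
    congr 1
    rw [← mul_assoc, ← pow_add, Nat.sub_add_cancel hie, mul_comm]
  have hfix : ∀ g : G, g • u • p ^ e • b = u • p ^ e • b := fun g => by
    rw [smul_comm, hbG]
  have hS : orbitSum G ψ a = ψ (u • p ^ e • b) * orbitSum G ψ a := by
    have h1 := orbitSum_smul ψ (k ^ p ^ (e - i)) (g₀ • a)
    rw [hw, orbitSum_add_fixed ψ _ _ hfix, orbitSum_smul] at h1
    exact h1.symm
  have hψ : ψ (u • p ^ e • b) = 1 := by
    have h2 : (ψ (u • p ^ e • b) - 1) * orbitSum G ψ a = 0 := by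
      rw [sub_mul, one_mul, ← hS, sub_self]
    simpa [ha, sub_eq_zero] using h2
  have h0 : u • p ^ e • b = 0 := faith _ fun g => by rw [hfix, hψ]
  have hord : addOrderOf (p ^ e • b) = p := by
    refine addOrderOf_eq_prime ?_ hb0
    rw [smul_smul, ← pow_succ']
    exact nsmul_eq_zero_of_mem_closure_orbit hae hb
  apply hu
  rw [← hord]
  exact addOrderOf_dvd_of_nsmul_eq_zero h0

omit hcomm in
lemma card_orbit_mul_le_card_closure (hcomm : ∀ (g h : G) (a : A), g • h • a = h • g • a)
    (faith : ∀ a, (∀ g : G, ψ (g • a) = 1) → a = 0)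
    {p : ℕ} (hp : p.Prime) (hodd : Odd p) (hG : IsPGroup p G) [Fintype G] [Finite A]
    (hA : ∃ m, Nat.card A = p ^ m) (a : A) (ha : orbitSum G ψ a ≠ 0) :
    Nat.card (MulAction.orbit G a) * addOrderOf a
      ≤ Nat.card (AddSubgroup.closure (MulAction.orbit G a)) := by
  have := Fact.mk hp
  set M := AddSubgroup.closure (MulAction.orbit G a) with hM
  obtain ⟨m, hm⟩ : ∃ m, Nat.card M = p ^ m := by
    obtain ⟨m, hm⟩ := hA
    obtain ⟨k, -, hk⟩ := (Nat.dvd_prime_pow hp).1 (hm ▸ AddSubgroup.card_addSubgroup_dvd_card M)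
    exact ⟨k, hk⟩
  obtain ⟨r, hr⟩ := hG.card_orbit a
  obtain ⟨e, he⟩ : ∃ e, addOrderOf a = p ^ e := by
    obtain ⟨m, hm⟩ := hA
    obtain ⟨k, -, hk⟩ := (Nat.dvd_prime_pow hp).1 (hm ▸ addOrderOf_dvd_natCard a)
    exact ⟨k, hk⟩
  have hsub : ∀ o ∈ MulAction.orbit G a, o ∈ M := fun o ho => AddSubgroup.subset_closure ho
  rcases e with _ | e
  · rw [he, pow_zero, mul_one]
    exact Nat.card_le_card_of_injective (fun o : MulAction.orbit G a => (⟨o, hsub o o.2⟩ : M))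
      fun o o' h => Subtype.ext (by simpa using h)
  have haM : a ∈ M := hsub a (MulAction.mem_orbit_self a)
  have hae : p ^ (e + 1) • a = 0 := he ▸ addOrderOf_nsmul_eq_zero a
  have hae' : p ^ e • a ≠ 0 := by
    intro h
    have h1 := Nat.le_of_dvd (pow_pos hp.pos e) (addOrderOf_dvd_of_nsmul_eq_zero h)
    rw [he] at h1
    exact absurd h1 (not_le.2 (Nat.pow_lt_pow_right hp.one_lt (Nat.lt_succ_self e)))
  obtain ⟨w, hwH, hw0, hw⟩ := exists_fixed_ne_zero hp hG hA
    (M.map (nsmulAddMonoidHom (α := A) (p ^ e)))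
    (by
      rintro g x ⟨y, hy, rfl⟩
      refine ⟨g • y, smul_mem_closure_orbit g hy, ?_⟩
      simp only [nsmulAddMonoidHom_apply]
      rw [smul_comm])
    (by
      intro hbot
      apply hae'
      have h1 : p ^ e • a ∈ M.map (nsmulAddMonoidHom (α := A) (p ^ e)) := ⟨a, haM, rfl⟩
      rwa [hbot, AddSubgroup.mem_bot] at h1)
  obtain ⟨b, hb, rfl⟩ := hwH
  simp only [nsmulAddMonoidHom_apply] at hw hw0
  -- Only multiples of `p • b` are used, since the binomial congruences need a translation divisible
  -- by `p`. This yields `p ^ e` translates of the orbit, one factor `p` short of `addOrderOf a = p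
  -- ^ (e + 1)`.
  let F : MulAction.orbit G a × Fin (p ^ e) → M := fun q =>
    ⟨(q.1 : A) + (p * (q.2 : ℕ)) • b, M.add_mem (hsub _ q.1.2) (M.nsmul_mem hb _)⟩
  have key : ∀ o ∈ MulAction.orbit G a, ∀ o' ∈ MulAction.orbit G a, ∀ t : ℕ, 0 < t → t < p ^ e →
      o ≠ o' + (p * t) • b := by
    rintro o ho o' ho' t ht hte h
    obtain ⟨i, u, hu, htu⟩ := Nat.exists_eq_pow_mul_and_not_dvd ht.ne' p hp.ne_one
    obtain ⟨g, rfl⟩ := ho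
    obtain ⟨g₀, rfl⟩ := ho'
    have hi : i < e := by
      have h1 : p ^ i ≤ t := Nat.le_of_dvd ht ⟨u, htu⟩
      exact (Nat.pow_lt_pow_iff_right hp.one_lt).1 (h1.trans_lt hte)
    refine not_orbit_eq_add ψ faith hcomm hp hodd ha hae hb hw0 hw (g * g₀⁻¹) g₀
      (i := i + 1) (u := u) (by omega) hi hu ?_
    rw [smul_smul, inv_mul_cancel_right]
    simp only at h
    rw [h, htu, pow_succ']
    congr 2
    ring
  have hF : Function.Injective F := by
    rintro ⟨o, j⟩ ⟨o', j'⟩ h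
    have h' : (o : A) + (p * (j : ℕ)) • b = o' + (p * (j' : ℕ)) • b := congrArg Subtype.val h
    rcases lt_trichotomy (j : ℕ) j' with hlt | heq | hlt
    · refine absurd ?_ (key o o.2 o' o'.2 (j' - j) (by omega) (by omega))
      obtain ⟨d, hd⟩ := Nat.exists_eq_add_of_lt hlt
      rw [hd, show j + d + 1 - (j : ℕ) = d + 1 by omega]
      rw [hd, add_assoc, mul_add, add_smul, add_left_comm] at h'
      rw [add_comm (o : A)] at h'
      exact add_left_cancel h'
    · rw [heq] at h'
      exact Prod.ext (Subtype.ext (add_right_cancel h')) (Fin.ext heq)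
    · refine absurd ?_ (key o' o'.2 o o.2 (j - j') (by omega) (by omega))
      obtain ⟨d, hd⟩ := Nat.exists_eq_add_of_lt hlt
      rw [hd, show j' + d + 1 - (j' : ℕ) = d + 1 by omega]
      rw [hd, add_assoc, mul_add, add_smul, add_left_comm] at h'
      rw [add_comm (o' : A)] at h'
      exact (add_left_cancel h').symm
  -- Multiplication by `p ^ e` kills `p • b` but no point of the orbit, so `0` is missed. All
  -- cardinalities are powers of `p`, so strict inequality supplies the missing factor `p`.
  have hF0 : ¬ Function.Surjective F := by
    intro hs
    obtain ⟨⟨o, j⟩, h⟩ := hs 0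
    have h' : (o : A) + (p * (j : ℕ)) • b = 0 := congrArg Subtype.val h
    obtain ⟨g, hg⟩ := o.2
    simp only at hg
    apply hae'
    have h1 : p ^ e • (o : A) = 0 := by
      have h2 := congrArg (p ^ e • ·) h'
      simp only [smul_add, smul_smul, smul_zero] at h2
      rw [← mul_assoc, ← pow_succ, mul_comm, mul_smul,
        nsmul_eq_zero_of_mem_closure_orbit hae hb, smul_zero, add_zero] at h2
      exact h2
    rw [← hg, smul_comm] at h1
    exact (smul_eq_zero_iff_eq g).1 h1
  have hlt : p ^ (r + e) < p ^ m := by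
    have : Nat.card (MulAction.orbit G a × Fin (p ^ e)) < Nat.card M := by
      refine lt_of_le_of_ne (Nat.card_le_card_of_injective F hF) fun h => hF0 ?_
      exact ((Nat.bijective_iff_injective_and_card F).2 ⟨hF, h⟩).2
    rwa [Nat.card_prod, hr, Nat.card_eq_fintype_card, Fintype.card_fin, ← pow_add, hm] at this
  rw [hr, he, ← pow_add, hm]
  exact Nat.pow_le_pow_right hp.pos (by
    have := (Nat.pow_lt_pow_iff_right hp.one_lt).1 hlt
    omega)

/-- The order of an element on which the orbit sum of `ψ` does not vanish. -/
theorem card_mul_addOrderOf_le (faith : ∀ a, (∀ g : G, ψ (g • a) = 1) → a = 0)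
    {p : ℕ} (hp : p.Prime) (hodd : Odd p) (hG : IsPGroup p G) [Fintype G] [Fintype A]
    (hA : ∃ m, Nat.card A = p ^ m) (a : A) (ha : orbitSum G ψ a ≠ 0) :
    Nat.card G * addOrderOf a ≤ Nat.card A * Nat.card (charStab G ψ) := by
  have h1 : Nat.card G = Nat.card (MulAction.orbit G a) * Nat.card (MulAction.stabilizer G a) := by
    rw [← Nat.card_prod]
    exact (Nat.card_congr (MulAction.orbitProdStabilizerEquivGroup G a)).symm
  calc Nat.card G * addOrderOf a
      = Nat.card (MulAction.stabilizer G a) * (Nat.card (MulAction.orbit G a) * addOrderOf a) := by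
        rw [h1]; ring
    _ ≤ Nat.card (MulAction.stabilizer G a) *
        Nat.card (AddSubgroup.closure (MulAction.orbit G a)) :=
        Nat.mul_le_mul_left _ (card_orbit_mul_le_card_closure ψ hcomm faith hp hodd hG hA a ha)
    _ ≤ _ := card_stabilizer_mul_card_closure_le hcomm ψ a

end OrbitModule

/-! ### Line stabilisers and induction from a linear character. -/

section EigenLines

variable {G V : Type*} [Group G] [AddCommGroup V] [Module ℂ V] (ρ : Representation ℂ G V)

/-- The stabiliser of the line through `v`. -/
def lineStab (v : V) : Subgroup G where
  carrier := {g | ∃ c : ℂ, ρ g v = c • v}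
  one_mem' := ⟨1, by simp⟩
  mul_mem' := by
    rintro g h ⟨c, hc⟩ ⟨d, hd⟩
    exact ⟨d * c, by rw [map_mul, Module.End.mul_apply, hd, map_smul, hc, smul_smul]⟩
  inv_mem' := by
    rintro g ⟨c, hc⟩
    have h1 : v = c • ρ g⁻¹ v := by
      rw [← map_smul, ← hc, ← Module.End.mul_apply, ← map_mul, inv_mul_cancel, map_one,
        Module.End.one_apply]
    by_cases h0 : c = 0
    · rw [h0, zero_smul] at h1
      exact ⟨0, by rw [h1, map_zero, smul_zero]⟩
    · exact ⟨c⁻¹, by conv_rhs => rw [h1, smul_smul, inv_mul_cancel₀ h0, one_smul]⟩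

/-- The joint eigenspace of `H` for `c` is `g`-invariant when `g` stabilises `c`, so `g` has an
eigenvector inside it. -/
lemma exists_common_eigenvector [FiniteDimensional ℂ V] (H : Subgroup G) {v : V} (hv : v ≠ 0)
    (c : G → ℂ) (hc : ∀ h ∈ H, ρ h v = c h • v) (g : G)
    (hg : ∀ h ∈ H, g⁻¹ * h * g ∈ H ∧ c (g⁻¹ * h * g) = c h) :
    ∃ w ≠ 0, (∀ h ∈ H, ρ h w = c h • w) ∧ g ∈ lineStab ρ w := by
  let E : Submodule ℂ V :=
    { carrier := {w | ∀ h ∈ H, ρ h w = c h • w}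
      zero_mem' := fun h _ => by simp
      add_mem' := fun {a b} ha hb h hh => by rw [map_add, ha h hh, hb h hh, smul_add]
      smul_mem' := fun r a ha h hh => by rw [map_smul, ha h hh, smul_comm] }
  have hE : ∀ w ∈ E, ρ g w ∈ E := by
    intro w hw h hh
    have h1 : ρ h (ρ g w) = ρ g (ρ (g⁻¹ * h * g) w) := by
      rw [← Module.End.mul_apply, ← Module.End.mul_apply, ← map_mul, ← map_mul]
      congr 2
      group
    rw [h1, hw _ (hg h hh).1, (hg h hh).2, map_smul]
  have : Nontrivial E := ⟨⟨⟨v, hc⟩, 0, fun h => hv (congrArg Subtype.val h)⟩⟩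
  obtain ⟨d, hd⟩ := Module.End.exists_eigenvalue ((ρ g).restrict hE)
  obtain ⟨w, hw⟩ := hd.exists_hasEigenvector
  refine ⟨w, fun h => hw.2 (Subtype.ext h), w.2, d, ?_⟩
  exact congrArg Subtype.val hw.apply_eq_smul

lemma exists_eigenvector_of_commute [FiniteDimensional ℂ V] [Nontrivial V] [Finite G]
    (K : Subgroup G) (hK : ∀ x ∈ K, ∀ y ∈ K, x * y = y * x) :
    ∃ v ≠ 0, K ≤ lineStab ρ v := by
  obtain ⟨v₀, hv₀⟩ := exists_ne (0 : V)
  -- A maximal stabiliser in `K` is all of `K`: otherwise a common eigenvector with a further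
  -- element of `K` would enlarge it.
  obtain ⟨H, hH⟩ := (Set.toFinite {H | ∃ v ≠ 0, H = lineStab ρ v ⊓ K}).exists_maximal
    ⟨_, v₀, hv₀, rfl⟩
  obtain ⟨v, hv, hHv⟩ := hH.prop
  refine ⟨v, hv, fun g hg => ?_⟩
  have hc : ∀ h : G, ∃ c : ℂ, h ∈ H → ρ h v = c • v := by
    intro h
    by_cases hh : h ∈ H
    · rw [hHv] at hh
      obtain ⟨c, hc⟩ := hh.1
      exact ⟨c, fun _ => hc⟩
    · exact ⟨0, fun h => absurd h hh⟩
  choose c hc using hc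
  obtain ⟨w, hw, hwH, hgw⟩ := exists_common_eigenvector ρ H hv c hc g (by
    intro h hh
    have hhK : h ∈ K := by rw [hHv] at hh; exact hh.2
    have : g⁻¹ * h * g = h := by rw [mul_assoc, hK h hhK g hg, inv_mul_cancel_left]
    rw [this]
    exact ⟨hh, rfl⟩)
  have hle : H ≤ lineStab ρ w ⊓ K := fun h hh =>
    ⟨⟨c h, hwH h hh⟩, by rw [hHv] at hh; exact hh.2⟩
  have hgH : g ∈ H := hH.le_of_ge ⟨w, hw, rfl⟩ hle ⟨hgw, hg⟩
  rw [hHv] at hgH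
  exact hgH.1

/-- A representation of a finite metabelian group contains an eigenvector of a subgroup `Z`
containing the derived subgroup, such that `Z` is the stabiliser of the corresponding linear
character. -/
lemma exists_self_stabilizing_eigenvector [FiniteDimensional ℂ V] [Nontrivial V] [Finite G]
    (hG : IsMetabelian G) :
    ∃ (Z : Subgroup G) (c : G → ℂ) (v : V), v ≠ 0 ∧ commutator G ≤ Z ∧
      (∀ z ∈ Z, ρ z v = c z • v) ∧ (∀ g ∉ Z, c g = 0) ∧
      ∀ g, (∀ z ∈ Z, c (g⁻¹ * z * g) = c z) → g ∈ Z := by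
  classical
  obtain ⟨v₀, hv₀, hv₀'⟩ := exists_eigenvector_of_commute ρ (commutator G) hG
  obtain ⟨Z, hZ⟩ :=
    (Set.toFinite {H | ∃ v ≠ 0, H = lineStab ρ v ∧ commutator G ≤ H}).exists_maximal
    ⟨_, v₀, hv₀, rfl, hv₀'⟩
  obtain ⟨v, hv, hZv, hcomm⟩ := hZ.prop
  -- Extension by zero off `Z` is the convention that makes the induced character formula a sum over
  -- the whole group.
  have hc : ∀ h : G, ∃ c : ℂ, (h ∈ Z → ρ h v = c • v) ∧ (h ∉ Z → c = 0) := by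
    intro h
    by_cases hh : h ∈ Z
    · have hh' := hh
      rw [hZv] at hh'
      obtain ⟨c, hc⟩ := hh'
      exact ⟨c, fun _ => hc, fun h => absurd hh h⟩
    · exact ⟨0, fun h => absurd h hh, fun _ => rfl⟩
  choose c hc hc0 using hc
  refine ⟨Z, c, v, hv, hcomm, hc, hc0, fun g hg => ?_⟩
  have hn : Z.Normal := Subgroup.Normal.of_commutator_le G hcomm
  obtain ⟨w, hw, hwH, hgw⟩ := exists_common_eigenvector ρ Z hv c hc g fun z hz =>
    ⟨by simpa using hn.conj_mem z hz g⁻¹, hg z hz⟩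
  have hle : Z ≤ lineStab ρ w := fun h hh => ⟨c h, hwH h hh⟩
  exact hZ.le_of_ge ⟨w, hw, rfl, hcomm.trans hle⟩ hle hgw

variable {ρ}

lemma eigen_mul {Z : Subgroup G} {c : G → ℂ} {v : V} (hv : v ≠ 0)
    (hc : ∀ z ∈ Z, ρ z v = c z • v) {x y : G} (hx : x ∈ Z) (hy : y ∈ Z) :
    c (x * y) = c x * c y := by
  have h := hc _ (Z.mul_mem hx hy)
  rw [map_mul, Module.End.mul_apply, hc y hy, map_smul, hc x hx, smul_smul] at h
  rw [mul_comm (c x)]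
  exact (smul_left_injective ℂ hv h).symm

lemma eigen_one {Z : Subgroup G} {c : G → ℂ} {v : V} (hv : v ≠ 0)
    (hc : ∀ z ∈ Z, ρ z v = c z • v) : c 1 = 1 := by
  have h := hc _ Z.one_mem
  rw [map_one, Module.End.one_apply] at h
  exact smul_left_injective ℂ hv (by simpa using h.symm)

lemma span_orbit_eq_top (hρ : ρ.IsIrreducible) {v : V} (hv : v ≠ 0) :
    Submodule.span ℂ (Set.range fun g => ρ g v) = ⊤ := by
  let W : Subrepresentation ρ := ⟨Submodule.span ℂ (Set.range fun g => ρ g v), by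
    intro g w hw
    induction hw using Submodule.span_induction with
    | mem x hx =>
      obtain ⟨h, rfl⟩ := hx
      refine Submodule.subset_span ⟨g * h, ?_⟩
      simp [map_mul]
    | zero => rw [map_zero]; exact Submodule.zero_mem _
    | add x y _ _ hx hy => rw [map_add]; exact Submodule.add_mem _ hx hy
    | smul a x _ hx => rw [map_smul]; exact Submodule.smul_mem _ _ hx⟩
  have hvW : v ∈ W.toSubmodule := Submodule.subset_span ⟨1, by simp⟩
  rcases hρ.eq_bot_or_eq_top W with h | h
  · rw [h] at hvW
    exact absurd ((Submodule.mem_bot ℂ).1 hvW) hv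
  · exact congrArg Subrepresentation.toSubmodule h

/-- An irreducible character which is induced from a linear character of a normal subgroup. -/
theorem card_mul_character_eq_sum [FiniteDimensional ℂ V] [Fintype G] (hρ : ρ.IsIrreducible)
    {Z : Subgroup G} [Z.Normal] {c : G → ℂ} {v : V} (hv : v ≠ 0)
    (hc : ∀ z ∈ Z, ρ z v = c z • v) (hc0 : ∀ g ∉ Z, c g = 0)
    (hstab : ∀ g, (∀ z ∈ Z, c (g⁻¹ * z * g) = c z) → g ∈ Z) (g : G) :
    Nat.card Z * ρ.character g = ∑ x : G, c (x⁻¹ * g * x) := by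
  classical
  have hN : (Nat.card Z : ℂ) ≠ 0 := Nat.cast_ne_zero.2 Nat.card_pos.ne'
  have hinv : ∀ z : Z, c (z : G)⁻¹ * c z = 1 := fun z => by
    rw [← eigen_mul hv hc (Z.inv_mem z.2) z.2, inv_mul_cancel, eigen_one hv hc]
  -- The idempotent projecting onto the `c`-eigenspace of `Z`; it turns out to have rank one.
  let e : Module.End ℂ V := (Nat.card Z : ℂ)⁻¹ • ∑ z : Z, c (z : G)⁻¹ • ρ z
  have he : e = (Nat.card Z : ℂ)⁻¹ • ∑ z : Z, c (z : G)⁻¹ • ρ z := rfl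
  have hle : ∀ z ∈ Z, ρ z * e = c z • e := by
    intro z₀ hz₀
    rw [he, mul_smul_comm, smul_comm (c z₀)]
    congr 1
    rw [Finset.mul_sum, Finset.smul_sum]
    refine Fintype.sum_equiv (Equiv.mulLeft (⟨z₀, hz₀⟩ : Z)) _ _ fun z => ?_
    have h1 : c (z : G)⁻¹ = c z₀ * c (z₀ * z)⁻¹ := by
      rw [mul_comm, ← eigen_mul hv hc (Z.inv_mem (Z.mul_mem hz₀ z.2)) hz₀, mul_inv_rev,
        inv_mul_cancel_right]
    rw [mul_smul_comm, ← map_mul, h1, smul_smul]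
    rfl
  have hre : ∀ z ∈ Z, e * ρ z = c z • e := by
    intro z₀ hz₀
    rw [he, smul_mul_assoc, smul_comm (c z₀)]
    congr 1
    rw [Finset.sum_mul, Finset.smul_sum]
    refine Fintype.sum_equiv (Equiv.mulRight (⟨z₀, hz₀⟩ : Z)) _ _ fun z => ?_
    have h1 : c (z : G)⁻¹ = c z₀ * c (z * z₀)⁻¹ := by
      rw [← eigen_mul hv hc hz₀ (Z.inv_mem (Z.mul_mem z.2 hz₀)), mul_inv_rev,
        mul_inv_cancel_left]
    rw [smul_mul_assoc, ← map_mul, h1, smul_smul]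
    rfl
  have hee : e * e = e := by
    have h1 : e * e = (Nat.card Z : ℂ)⁻¹ • ∑ z : Z, c (z : G)⁻¹ • (ρ z * e) := by
      conv_lhs => rw [he, smul_mul_assoc, ← he, Finset.sum_mul]
      simp_rw [smul_mul_assoc]
    rw [h1]
    simp_rw [fun z : Z => hle z z.2, smul_smul, hinv, one_smul]
    rw [Finset.sum_const, Finset.card_univ, ← Nat.card_eq_fintype_card, ← Nat.cast_smul_eq_nsmul ℂ,
      smul_smul, inv_mul_cancel₀ hN, one_smul]
  have hev : e v = v := by
    change ((Nat.card Z : ℂ)⁻¹ • ∑ z : Z, c (z : G)⁻¹ • ρ z) v = v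
    rw [LinearMap.smul_apply, LinearMap.sum_apply]
    simp_rw [LinearMap.smul_apply, fun z : Z => hc z z.2, smul_smul, hinv, one_smul]
    rw [Finset.sum_const, Finset.card_univ, ← Nat.card_eq_fintype_card, ← Nat.cast_smul_eq_nsmul ℂ,
      smul_smul, inv_mul_cancel₀ hN, one_smul]
  -- `h` carries the `c`-eigenspace to that of a different conjugate character, and `e` annihilates
  -- the latter.
  have hehe : ∀ h ∉ Z, e * ρ h * e = 0 := by
    intro h hh
    obtain ⟨z, hz, hzc⟩ : ∃ z ∈ Z, c (h⁻¹ * z * h) ≠ c z := by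
      by_contra! hcon
      exact hh (hstab h hcon)
    have hz' : h⁻¹ * z * h ∈ Z := by
      simpa using Subgroup.Normal.conj_mem ‹Z.Normal› z hz h⁻¹
    have h1 : c z • (e * ρ h * e) = c (h⁻¹ * z * h) • (e * ρ h * e) := by
      rw [← smul_mul_assoc, ← smul_mul_assoc, ← hre z hz, ← mul_smul_comm, ← hle _ hz',
        mul_assoc e, ← map_mul, mul_assoc e (ρ h), ← mul_assoc (ρ h), ← map_mul,
        show h * (h⁻¹ * z * h) = z * h by group, mul_assoc]
    by_contra hne
    exact hzc (smul_left_injective ℂ hne h1).symm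
  have heρ : ∀ y, e (ρ y v) = c y • v := by
    intro y
    by_cases hy : y ∈ Z
    · rw [hc y hy, map_smul, hev]
    · have h1 := congrArg (fun f : Module.End ℂ V => f v) (hehe y hy)
      simp only [Module.End.mul_apply, hev, LinearMap.zero_apply] at h1
      rw [h1, hc0 y hy, zero_smul]
  have htop := span_orbit_eq_top hρ hv
  have htre : LinearMap.trace ℂ V e = 1 := by
    have hproj : LinearMap.IsProj (Submodule.span ℂ {v}) e := by
      constructor
      · intro x
        have hx : x ∈ Submodule.span ℂ (Set.range fun g => ρ g v) := htop ▸ Submodule.mem_top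
        induction hx using Submodule.span_induction with
        | mem x hx =>
          obtain ⟨y, rfl⟩ := hx
          simp only [heρ]
          exact Submodule.smul_mem _ _ (Submodule.mem_span_singleton_self v)
        | zero => rw [map_zero]; exact Submodule.zero_mem _
        | add x y _ _ hx hy => rw [map_add]; exact Submodule.add_mem _ hx hy
        | smul a x _ hx => rw [map_smul]; exact Submodule.smul_mem _ _ hx
      · intro x hx
        obtain ⟨a, rfl⟩ := Submodule.mem_span_singleton.1 hx
        rw [map_smul, hev]
    rw [hproj.trace, finrank_span_singleton hv, Nat.cast_one]
  -- The conjugates of `e` project onto the lines through the translates of `v`; each line occurs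
  -- once for every element of a coset of `Z`. Multiplying by `ρ g` and taking traces gives the
  -- formula.
  have hQ : ∑ x : G, ρ x * e * ρ x⁻¹ = (Nat.card Z : ℂ) • (1 : Module.End ℂ V) := by
    refine LinearMap.ext_on_range htop fun y => ?_
    rw [LinearMap.sum_apply, LinearMap.smul_apply, Module.End.one_apply]
    have h1 : ∀ x : G, (ρ x * e * ρ x⁻¹) (ρ y v) = if x⁻¹ * y ∈ Z then ρ y v else 0 := by
      intro x
      have h2 : (ρ x * e * ρ x⁻¹) (ρ y v) = ρ x (e (ρ (x⁻¹ * y) v)) := by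
        rw [map_mul]; rfl
      rw [h2, heρ]
      split_ifs with h
      · rw [← hc _ h, ← Module.End.mul_apply, ← map_mul, mul_inv_cancel_left]
      · rw [hc0 _ h, zero_smul, map_zero]
    simp_rw [h1]
    have h3 : (∑ x : G, if x⁻¹ * y ∈ Z then ρ y v else 0) = ∑ x : G, if x ∈ Z then ρ y v else 0 :=
      Fintype.sum_equiv ((Equiv.inv G).trans (Equiv.mulRight y)) _ _ fun x => rfl
    rw [h3, ← Finset.sum_filter, Finset.sum_const, ← Nat.cast_smul_eq_nsmul ℂ,
      Nat.card_eq_fintype_card, Fintype.card_subtype]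
  have htr : ∀ h, LinearMap.trace ℂ V (ρ h * e) = c h := by
    intro h
    by_cases hh : h ∈ Z
    · rw [hle h hh, map_smul, htre, smul_eq_mul, mul_one]
    · rw [hc0 h hh, ← hee, ← mul_assoc, LinearMap.trace_mul_comm, ← mul_assoc, hehe h hh, map_zero]
  calc Nat.card Z * ρ.character g
      = LinearMap.trace ℂ V (ρ g * ∑ x : G, ρ x * e * ρ x⁻¹) := by
        rw [hQ, mul_smul_comm, mul_one, map_smul, smul_eq_mul]
        rfl
    _ = ∑ x : G, LinearMap.trace ℂ V (ρ (x⁻¹ * g * x) * e) := by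
        rw [Finset.mul_sum, map_sum]
        refine Finset.sum_congr rfl fun x _ => ?_
        rw [← mul_assoc, LinearMap.trace_mul_comm, map_mul ρ, map_mul ρ]
        simp only [mul_assoc]
    _ = ∑ x : G, c (x⁻¹ * g * x) := by simp_rw [htr]

end EigenLines

/-! ### The module attached to the conjugates of a linear character. -/

section ConjugateCharacters

variable {P : Type*} [Group P] {Z : Subgroup P} [hZ : Z.Normal]

/-- An element of the normal subgroup `Z`, viewed as the function giving the values of the
conjugates of a linear character `μ` of `Z`. -/
def conjFun (μ : Z →* ℂˣ) : Z →* (P → ℂˣ) where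
  toFun := fun a x => μ (MulAut.conjNormal x a)
  map_one' := by ext; simp
  map_mul' := fun a b => by ext; simp

lemma conjFun_apply (μ : Z →* ℂˣ) (a : Z) (x : P) :
    conjFun μ a x = μ (MulAut.conjNormal x a) := rfl

/-- The group generated by the conjugates of `μ`, as the dual of a quotient of `Z`. -/
abbrev ConjDual (μ : Z →* ℂˣ) := Additive (conjFun μ).range

/-- The image of an element of `Z`. -/
def toConjDual (μ : Z →* ℂˣ) (a : Z) : ConjDual μ := Additive.ofMul ⟨conjFun μ a, a, rfl⟩

/-- The value of the function underlying an element of `ConjDual μ`. -/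
def ConjDual.eval {μ : Z →* ℂˣ} (F : ConjDual μ) (x : P) : ℂˣ := ((Additive.toMul F : (conjFun μ).range) : P → ℂˣ) x

lemma ConjDual.ext {μ : Z →* ℂˣ} {F F' : ConjDual μ} (h : ∀ x, F.eval x = F'.eval x) : F = F' :=
  Additive.toMul.injective (Subtype.ext (funext h))

lemma eval_toConjDual (μ : Z →* ℂˣ) (a : Z) (x : P) :
    (toConjDual μ a).eval x = μ (MulAut.conjNormal x a) := rfl

lemma eval_add {μ : Z →* ℂˣ} (F F' : ConjDual μ) (x : P) :
    (F + F').eval x = F.eval x * F'.eval x := rfl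

lemma eval_zero {μ : Z →* ℂˣ} (x : P) : (0 : ConjDual μ).eval x = 1 := rfl

lemma toConjDual_surjective (μ : Z →* ℂˣ) : Function.Surjective (toConjDual μ) := by
  rintro ⟨F, a, rfl⟩
  exact ⟨a, rfl⟩

instance conjDualAction (μ : Z →* ℂˣ) : DistribMulAction P (ConjDual μ) where
  smul := fun k F => Additive.ofMul ⟨fun x => F.eval (x * k), by
    obtain ⟨a, rfl⟩ := toConjDual_surjective μ F
    refine ⟨MulAut.conjNormal k a, funext fun x => ?_⟩
    rw [eval_toConjDual, conjFun_apply, map_mul, MulAut.mul_apply]⟩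
  one_smul := fun F => ConjDual.ext fun x => congrArg F.eval (mul_one x)
  mul_smul := fun k l F => ConjDual.ext fun x => congrArg F.eval (mul_assoc x k l).symm
  smul_zero := fun k => rfl
  smul_add := fun k F F' => rfl

lemma eval_smul {μ : Z →* ℂˣ} (k : P) (F : ConjDual μ) (x : P) :
    (k • F).eval x = F.eval (x * k) := rfl

lemma smul_toConjDual (μ : Z →* ℂˣ) (k : P) (a : Z) :
    k • toConjDual μ a = toConjDual μ (MulAut.conjNormal k a) := by
  refine ConjDual.ext fun x => ?_
  rw [eval_smul, eval_toConjDual, eval_toConjDual, map_mul, MulAut.mul_apply]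

/-- Evaluation at the identity. -/
def evalOne (μ : Z →* ℂˣ) : AddChar (ConjDual μ) ℂ where
  toFun := fun F => (F.eval 1 : ℂ)
  map_zero_eq_one' := by rw [eval_zero, Units.val_one]
  map_add_eq_mul' := fun F F' => by rw [eval_add, Units.val_mul]

lemma evalOne_smul {μ : Z →* ℂˣ} (F : ConjDual μ) (k : P) :
    evalOne μ (k • F) = (F.eval k : ℂ) := by
  change ((k • F).eval 1 : ℂ) = _
  rw [eval_smul, one_mul]

lemma eq_zero_of_evalOne_smul {μ : Z →* ℂˣ} (F : ConjDual μ)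
    (h : ∀ k : P, evalOne μ (k • F) = 1) : F = 0 := by
  refine ConjDual.ext fun x => Units.ext ?_
  rw [← evalOne_smul, h, eval_zero, Units.val_one]

-- `x * k * l` and `x * l * k` differ by an element of `Z`, and conjugation inside `Z` does not
-- change the values of `μ`.
open scoped commutatorElement in
lemma conjDual_smul_comm (μ : Z →* ℂˣ) (hcomm : commutator P ≤ Z) (k l : P) (F : ConjDual μ) :
    k • l • F = l • k • F := by
  obtain ⟨a, rfl⟩ := toConjDual_surjective μ F
  refine ConjDual.ext fun x => ?_
  rw [eval_smul, eval_smul, eval_smul, eval_smul, eval_toConjDual, eval_toConjDual]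
  have hz : x * k * l * (x * l * k)⁻¹ ∈ Z := by
    apply hcomm
    have h1 : x * k * l * (x * l * k)⁻¹ = x * ⁅k, l⁆ * x⁻¹ := by
      rw [commutatorElement_def]; group
    rw [h1]
    exact (inferInstance : (commutator P).Normal).conj_mem _
      (Subgroup.commutator_mem_commutator (Subgroup.mem_top k) (Subgroup.mem_top l)) x
  have h2 : MulAut.conjNormal (x * k * l) a
      = ⟨_, hz⟩ * MulAut.conjNormal (x * l * k) a * (⟨_, hz⟩ : Z)⁻¹ := by
    refine Subtype.ext ?_
    simp only [MulAut.conjNormal_apply, Subgroup.coe_mul, Subgroup.coe_inv]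
    group
  rw [h2, map_mul, map_mul, map_inv, mul_inv_cancel_comm]

lemma orbitSum_toConjDual [Fintype P] (μ : Z →* ℂˣ) (a : Z) :
    orbitSum P (evalOne μ) (toConjDual μ a) = ∑ x : P, (μ (MulAut.conjNormal x a) : ℂ) := by
  unfold orbitSum
  simp_rw [evalOne_smul, eval_toConjDual]

lemma charStab_evalOne_le (μ : Z →* ℂˣ)
    (hstab : ∀ g : P, (∀ z : Z, μ (MulAut.conjNormal g z) = μ z) → g ∈ Z) :
    charStab P (evalOne μ) ≤ Z := by
  intro g hg
  refine hstab g fun z => Units.ext ?_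
  have h := hg (toConjDual μ z)
  rw [evalOne_smul, eval_toConjDual] at h
  rw [h, ← one_smul P (toConjDual μ z), evalOne_smul, eval_toConjDual, map_one, MulAut.one_apply]

variable [Finite P]

instance (μ : Z →* ℂˣ) : Finite (ConjDual μ) :=
  Finite.of_surjective _ (toConjDual_surjective μ)

omit [Finite P] in
lemma card_conjDual (μ : Z →* ℂˣ) :
    Nat.card (ConjDual μ) * Nat.card (conjFun μ).ker = Nat.card Z := by
  rw [Subgroup.card_eq_card_quotient_mul_card_subgroup (conjFun μ).ker]
  congr 1
  exact (Nat.card_congr (QuotientGroup.quotientKerEquivRange (conjFun μ)).toEquiv).symm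

lemma card_conjDual_eq_pow {p : ℕ} (hp : p.Prime) (hP : IsPGroup p P) (μ : Z →* ℂˣ) :
    ∃ m, Nat.card (ConjDual μ) = p ^ m := by
  have := Fact.mk hp
  obtain ⟨n, hn⟩ := (IsPGroup.iff_card.1 (hP.to_subgroup Z))
  obtain ⟨m, -, hm⟩ := (Nat.dvd_prime_pow hp).1 (hn ▸ Dvd.intro _ (card_conjDual μ))
  exact ⟨m, hm⟩

omit [Finite P] in
lemma toConjDual_eq_iff (μ : Z →* ℂˣ) (a b : Z) :
    toConjDual μ a = toConjDual μ b ↔ conjFun μ a = conjFun μ b := by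
  constructor
  · intro h
    exact congrArg (fun F : ConjDual μ => ((Additive.toMul F : (conjFun μ).range) : P → ℂˣ)) h
  · intro h
    exact ConjDual.ext fun x => congrFun h x

lemma card_centralizer_le (μ : Z →* ℂˣ) (a : Z) :
    Nat.card (Subgroup.centralizer {(a : P)})
      ≤ Nat.card (MulAction.stabilizer P (toConjDual μ a)) := by
  refine Subgroup.card_le_of_le fun k hk => ?_
  rw [MulAction.mem_stabilizer_iff, smul_toConjDual]
  congr 1
  refine Subtype.ext ?_
  rw [MulAut.conjNormal_apply, Subgroup.mem_centralizer_singleton_iff.1 hk, mul_inv_cancel_right]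

open Classical in
omit [Finite P] in
lemma sum_toConjDual [Fintype Z] (μ : Z →* ℂˣ) [Fintype (ConjDual μ)] (f : ConjDual μ → ℕ) :
    ∑ a : Z, f (toConjDual μ a) = Nat.card (conjFun μ).ker * ∑ F, f F := by
  rw [← Finset.sum_fiberwise (s := Finset.univ) (g := toConjDual μ), Finset.mul_sum]
  refine Finset.sum_congr rfl fun F _ => ?_
  obtain ⟨b, rfl⟩ := toConjDual_surjective μ F
  have h1 : ∀ a ∈ Finset.univ.filter (fun a => toConjDual μ a = toConjDual μ b),
      f (toConjDual μ a) = f (toConjDual μ b) := fun a ha => by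
    rw [(Finset.mem_filter.1 ha).2]
  rw [Finset.sum_congr rfl h1, Finset.sum_const, smul_eq_mul]
  congr 1
  rw [← Fintype.card_subtype, ← Nat.card_eq_fintype_card]
  -- The fibres of `toConjDual` are the cosets of the kernel.
  refine Nat.card_congr ((Equiv.mulLeft b⁻¹).subtypeEquiv fun a => ?_)
  rw [toConjDual_eq_iff, MonoidHom.mem_ker]
  simp only [Equiv.coe_mulLeft, map_mul, map_inv]
  rw [inv_mul_eq_one, eq_comm]

open Classical in
theorem sum_card_centralizer_le [Fintype P] {p : ℕ} (hp : p.Prime) (hP : IsPGroup p P)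
    (hcomm : commutator P ≤ Z) (μ : Z →* ℂˣ)
    (hstab : ∀ g : P, (∀ z : Z, μ (MulAut.conjNormal g z) = μ z) → g ∈ Z) :
    (∑ a : Z, if ∑ x : P, (μ (MulAut.conjNormal x a) : ℂ) ≠ 0
      then Nat.card (Subgroup.centralizer {(a : P)}) else 0) ≤ Nat.card Z ^ 2 := by
  have := Fintype.ofFinite (ConjDual μ)
  let f : ConjDual μ → ℕ := fun F =>
    if orbitSum P (evalOne μ) F ≠ 0 then Nat.card (MulAction.stabilizer P F) else 0
  calc _ ≤ ∑ a : Z, f (toConjDual μ a) := by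
        refine Finset.sum_le_sum fun a _ => ?_
        simp only [f, orbitSum_toConjDual]
        split_ifs
        · exact card_centralizer_le μ a
        · exact le_rfl
    _ = Nat.card (conjFun μ).ker * ∑ F, f F := sum_toConjDual μ f
    _ ≤ Nat.card (conjFun μ).ker * (Nat.card (ConjDual μ) * Nat.card (charStab P (evalOne μ))) :=
        Nat.mul_le_mul_left _ (sum_stabilizer_le (conjDual_smul_comm μ hcomm) _
          eq_zero_of_evalOne_smul hp hP (card_conjDual_eq_pow hp hP μ))
    _ = Nat.card Z * Nat.card (charStab P (evalOne μ)) := by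
        rw [← card_conjDual μ]; ring
    _ ≤ Nat.card Z ^ 2 := by
        rw [sq]
        exact Nat.mul_le_mul_left _ (Subgroup.card_le_of_le (charStab_evalOne_le μ hstab))

/-- The power of `a` that dies in the quotient lies in the kernel, whose order bounds what remains.
-/
lemma orderOf_le_mul_addOrderOf (μ : Z →* ℂˣ) (a : Z) :
    orderOf a ≤ Nat.card (conjFun μ).ker * addOrderOf (toConjDual μ a) := by
  refine orderOf_le_of_pow_eq_one (Nat.mul_pos Nat.card_pos (addOrderOf_pos _)) ?_
  have h : a ^ addOrderOf (toConjDual μ a) ∈ (conjFun μ).ker := by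
    rw [MonoidHom.mem_ker, map_pow]
    exact congrArg (fun F : ConjDual μ => ((Additive.toMul F : (conjFun μ).range) : P → ℂˣ))
      (addOrderOf_nsmul_eq_zero (toConjDual μ a))
  rw [mul_comm, pow_mul]
  exact congrArg Subtype.val (pow_card_eq_one' (x := (⟨_, h⟩ : (conjFun μ).ker)))

theorem card_mul_orderOf_le [Fintype P] {p : ℕ} (hp : p.Prime) (hodd : Odd p) (hP : IsPGroup p P)
    (hcomm : commutator P ≤ Z) (μ : Z →* ℂˣ)
    (hstab : ∀ g : P, (∀ z : Z, μ (MulAut.conjNormal g z) = μ z) → g ∈ Z) (a : Z)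
    (ha : ∑ x : P, (μ (MulAut.conjNormal x a) : ℂ) ≠ 0) :
    Nat.card P * orderOf a ≤ Nat.card Z ^ 2 := by
  have := Fintype.ofFinite (ConjDual μ)
  calc Nat.card P * orderOf a
      ≤ Nat.card P * (Nat.card (conjFun μ).ker * addOrderOf (toConjDual μ a)) :=
        Nat.mul_le_mul_left _ (orderOf_le_mul_addOrderOf μ a)
    _ = Nat.card (conjFun μ).ker * (Nat.card P * addOrderOf (toConjDual μ a)) := by ring
    _ ≤ Nat.card (conjFun μ).ker * (Nat.card (ConjDual μ) * Nat.card (charStab P (evalOne μ))) :=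
        Nat.mul_le_mul_left _ (card_mul_addOrderOf_le (conjDual_smul_comm μ hcomm) _
          eq_zero_of_evalOne_smul hp hodd hP (card_conjDual_eq_pow hp hP μ) _
          (by rwa [orbitSum_toConjDual]))
    _ = Nat.card Z * Nat.card (charStab P (evalOne μ)) := by
        rw [← card_conjDual μ]; ring
    _ ≤ Nat.card Z ^ 2 := by
        rw [sq]
        exact Nat.mul_le_mul_left _ (Subgroup.card_le_of_le (charStab_evalOne_le μ hstab))

end ConjugateCharacters

/-! ### Counting classes by centraliser orders. -/

section ConjugacyClasses

variable {G : Type*} [Group G] [Fintype G]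

omit [Fintype G] in
lemma card_carrier_mul_card_centralizer (g : G) :
    Nat.card (ConjClasses.mk g).carrier * Nat.card (Subgroup.centralizer {g}) = Nat.card G := by
  rw [← ConjAct.orbit_eq_carrier_conjClasses, Subgroup.nat_card_centralizer_nat_card_stabilizer,
    ← Nat.card_prod]
  exact (Nat.card_congr (MulAction.orbitProdStabilizerEquivGroup (ConjAct G) g))

-- Over a single class the centraliser orders add up to `|G|`, by orbit-stabiliser.
open Classical in
lemma numConjClasses_mul_card (S : Set G) (hS : ∀ g ∈ S, ∀ x, x * g * x⁻¹ ∈ S) :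
    numConjClasses S * Nat.card G
      = ∑ g : G, if g ∈ S then Nat.card (Subgroup.centralizer {g}) else 0 := by
  have := Fintype.ofFinite (ConjClasses G)
  have hmem : ∀ g, g ∈ S ↔ (ConjClasses.mk g).carrier ⊆ S := by
    intro g
    constructor
    · intro hg h hh
      rw [ConjClasses.mem_carrier_iff_mk_eq, ConjClasses.mk_eq_mk_iff_isConj, isConj_comm,
        isConj_iff] at hh
      obtain ⟨x, rfl⟩ := hh
      exact hS g hg x
    · exact fun h => h ConjClasses.mem_carrier_mk
  rw [← Finset.sum_fiberwise (s := Finset.univ) (g := ConjClasses.mk)]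
  have h1 : ∀ C : ConjClasses G, (∑ g ∈ Finset.univ.filter (fun g => ConjClasses.mk g = C),
      if g ∈ S then Nat.card (Subgroup.centralizer {g}) else 0)
      = if C.carrier ⊆ S then Nat.card G else 0 := by
    intro C
    obtain ⟨x, rfl⟩ := C.exists_rep
    split_ifs with hx
    · have h2 : ∀ g ∈ Finset.univ.filter (fun g => ConjClasses.mk g = ConjClasses.mk x),
          (if g ∈ S then Nat.card (Subgroup.centralizer {g}) else 0)
            = Nat.card (Subgroup.centralizer {x}) := by
        intro g hg
        have hgx := (Finset.mem_filter.1 hg).2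
        rw [if_pos ((hmem g).2 (hgx ▸ hx))]
        have e := (card_carrier_mul_card_centralizer g).trans
          (card_carrier_mul_card_centralizer x).symm
        rw [hgx] at e
        refine Nat.eq_of_mul_eq_mul_left ?_ e
        have : Nonempty (ConjClasses.mk x).carrier := ⟨⟨x, ConjClasses.mem_carrier_mk⟩⟩
        exact Nat.card_pos
      rw [Finset.sum_congr rfl h2, Finset.sum_const, smul_eq_mul,
        ← card_carrier_mul_card_centralizer x]
      congr 1
      rw [← Fintype.card_subtype, ← Nat.card_eq_fintype_card]
      exact Nat.card_congr (Equiv.subtypeEquivRight fun g =>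
        ConjClasses.mem_carrier_iff_mk_eq.symm)
    · refine Finset.sum_eq_zero fun g hg => if_neg fun hgS => hx ?_
      rw [← (Finset.mem_filter.1 hg).2]
      exact (hmem g).1 hgS
  simp_rw [h1]
  rw [← Finset.sum_filter, Finset.sum_const, smul_eq_mul]
  congr 1
  unfold numConjClasses
  rw [Set.ncard_eq_toFinset_card']
  congr 1
  ext C
  simp

end ConjugacyClasses

/-! ### Passage from characters of the group to the module, and the theorem. -/

section Main

variable {P : Type*} [Group P]

/-- An irreducible character of a finite metabelian group is induced from a linear character of a
subgroup containing the derived subgroup. -/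
theorem exists_inducing_linear_character [Fintype P] (hmet : IsMetabelian P) (χ : P → ℂ)
    (hχ : χ ∈ Irr P) :
    ∃ (Z : Subgroup P) (_ : Z.Normal) (μ : Z →* ℂˣ) (d : ℕ), commutator P ≤ Z ∧
      (∀ g : P, (∀ z : Z, μ (MulAut.conjNormal g z) = μ z) → g ∈ Z) ∧
      χ 1 = d ∧ Nat.card Z * d = Nat.card P ∧ (∀ g ∉ Z, χ g = 0) ∧
      ∀ a : Z, Nat.card Z * χ a = ∑ x : P, (μ (MulAut.conjNormal x a) : ℂ) := by
  obtain ⟨n, ρ, hρ, rfl⟩ := hχ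
  have hnt : Nontrivial (Fin n → ℂ) := by
    by_contra h
    rw [not_nontrivial_iff_subsingleton] at h
    obtain ⟨W, W', hne⟩ := hρ.exists_pair_ne
    apply hne
    have : W.toSubmodule = W'.toSubmodule := Subsingleton.elim _ _
    cases W
    cases W'
    simpa using this
  obtain ⟨Z, c, v, hv, hcomm, hc, hc0, hstab⟩ := exists_self_stabilizing_eigenvector ρ hmet
  have hZ : Z.Normal := Subgroup.Normal.of_commutator_le P hcomm
  have hform := card_mul_character_eq_sum hρ hv hc hc0 hstab
  let μ₀ : Z →* ℂ :=
    { toFun := fun z => c z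
      map_one' := eigen_one hv hc
      map_mul' := fun x y => eigen_mul hv hc x.2 y.2 }
  have hμ : ∀ z : Z, (μ₀.toHomUnits z : ℂ) = c z := fun z => rfl
  have hN : (Nat.card Z : ℂ) ≠ 0 := Nat.cast_ne_zero.2 Nat.card_pos.ne'
  refine ⟨Z, hZ, μ₀.toHomUnits, n, hcomm, ?_, ?_, ?_, ?_, ?_⟩
  · intro g hg
    -- `hstab` conjugates as `g⁻¹ * z * g`, while `MulAut.conjNormal g` gives `g * z * g⁻¹`.
    rw [← inv_mem_iff]
    refine hstab _ fun z hz => ?_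
    have := congrArg Units.val (hg ⟨z, hz⟩)
    rw [hμ, hμ, MulAut.conjNormal_apply] at this
    rwa [inv_inv]
  · simp [Representation.character]
  · have h1 := hform 1
    simp only [mul_one, inv_mul_cancel, eigen_one hv hc, Finset.sum_const, Finset.card_univ,
      nsmul_eq_mul] at h1
    simp only [Representation.character, map_one, LinearMap.trace_one, Module.finrank_fin_fun] at h1
    rw [Nat.card_eq_fintype_card (α := P)]
    exact_mod_cast h1
  · intro g hg
    have h1 := hform g
    rw [Finset.sum_eq_zero] at h1
    · exact (mul_eq_zero.1 h1).resolve_left hN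
    · intro x _
      refine hc0 _ fun h => hg ?_
      have := hZ.conj_mem _ h x
      simpa [mul_assoc] using this
  · intro a
    rw [hform]
    refine Fintype.sum_equiv (Equiv.inv P) _ _ fun x => ?_
    rw [hμ, MulAut.conjNormal_apply]
    simp

lemma character_conj_ne_zero (χ : P → ℂ) (hχ : χ ∈ Irr P) (g : P) (hg : g ∈ Supp χ) (x : P) :
    x * g * x⁻¹ ∈ Supp χ := by
  obtain ⟨n, ρ, -, rfl⟩ := hχ
  change ρ.character _ ≠ 0
  have h : ρ.character (x * g * x⁻¹) = ρ.character g := by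
    simp only [Representation.character]
    rw [map_mul ρ, LinearMap.trace_mul_comm, ← map_mul ρ, inv_mul_cancel_left]
  rw [h]
  exact hg

end Main

theorem theoremA {p : ℕ} (hp : p.Prime) {P : Type*} [Group P] [Finite P]
    (hP : IsPGroup p P) (hmet : IsMetabelian P) (χ : P → ℂ) (hχ : χ ∈ Irr P) :
    ∃ d : ℕ, 0 < d ∧ χ 1 = (d : ℂ) ∧
      (numConjClasses (Supp χ) : ℝ) ≤ (Nat.card P : ℝ) / (d : ℝ) ^ 2 ∧
      (Odd p → ∀ x ∈ Supp χ,
        (orderOf x : ℝ) ≤ (Nat.card P : ℝ) / (d : ℝ) ^ (3 / 2 : ℝ)) := by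
  classical
  have := Fintype.ofFinite P
  obtain ⟨Z, hZ, μ, d, hcomm, hstab, hd, hcard, hoff, hform⟩ :=
    exists_inducing_linear_character hmet χ hχ
  have hcP : 0 < Nat.card P := Nat.card_pos
  have hcZ : 0 < Nat.card Z := Nat.card_pos
  have hd0 : 0 < d := Nat.pos_of_ne_zero fun h => by
    rw [h, mul_zero] at hcard
    omega
  have hN : (Nat.card Z : ℂ) ≠ 0 := Nat.cast_ne_zero.2 hcZ.ne'
  have hsupp : ∀ a : Z, (a : P) ∈ Supp χ ↔ ∑ x : P, (μ (MulAut.conjNormal x a) : ℂ) ≠ 0 := by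
    intro a
    rw [← hform a]
    change χ a ≠ 0 ↔ _
    simp
  -- As `|Z| d = |P|`, the bound `|Z| ^ 2 / |P|` is `|P| / d ^ 2`; it serves both for the class
  -- count and for the order.
  have hbound : ∀ r : ℕ, Nat.card P * r ≤ Nat.card Z ^ 2 → r * d ^ 2 ≤ Nat.card P := by
    intro r hr
    refine Nat.le_of_mul_le_mul_left ?_ hcP
    calc Nat.card P * (r * d ^ 2) = (Nat.card P * r) * d ^ 2 := by ring
      _ ≤ Nat.card Z ^ 2 * d ^ 2 := Nat.mul_le_mul_right _ hr
      _ = Nat.card P * Nat.card P := by rw [← mul_pow, hcard, sq]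
  have hdR : (1 : ℝ) ≤ d := by exact_mod_cast hd0
  refine ⟨d, hd0, hd, ?_, ?_⟩
  · rw [le_div_iff₀ (by positivity)]
    have h : Nat.card P * numConjClasses (Supp χ) ≤ Nat.card Z ^ 2 := by
      rw [mul_comm, numConjClasses_mul_card _ (character_conj_ne_zero χ hχ)]
      refine le_trans (le_of_eq ?_) (sum_card_centralizer_le hp hP hcomm μ hstab)
      simp_rw [← hsupp]
      rw [← Finset.sum_subtype (Finset.univ.filter (fun g : P => g ∈ Z)) (by simp)
        (fun g => if g ∈ Supp χ then Nat.card (Subgroup.centralizer {g}) else 0),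
        Finset.sum_filter_of_ne]
      intro g _ hg
      by_contra hgZ
      exact hg (if_neg fun h => h (hoff g hgZ))
    exact_mod_cast hbound _ h
  · intro hodd x hx
    have hxZ : x ∈ Z := by
      by_contra h
      exact hx (hoff x h)
    have h := card_mul_orderOf_le hp hodd hP hcomm μ hstab ⟨x, hxZ⟩ ((hsupp ⟨x, hxZ⟩).1 hx)
    rw [Subgroup.orderOf_mk] at h
    have h2 : (orderOf x * d ^ 2 : ℝ) ≤ Nat.card P := by exact_mod_cast hbound _ h
    rw [le_div_iff₀ (by positivity)]
    -- The order bound with exponent `2` is weakened to `3 / 2` using `d ≥ 1`.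
    refine le_trans (mul_le_mul_of_nonneg_left ?_ (Nat.cast_nonneg _)) h2
    calc (d : ℝ) ^ (3 / 2 : ℝ) ≤ (d : ℝ) ^ (2 : ℝ) :=
          Real.rpow_le_rpow_of_exponent_le hdR (by norm_num)
      _ = (d : ℝ) ^ 2 := by norm_cast
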